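/- Fix an integer $n\ge 1$. Let $B_{2n}$ be the braid group on $2n$ strands with Artin generators $\sigma_1,\dots,\sigma_{2n-1}$, and let $<_D$ be the Dehornoy order on it: $\beta<_D\gamma$ if and only if $\beta^{-1}\gamma$ is represented by a nonempty braid word in which the generator $\sigma_i$ of smallest index that occurs never occurs with a negative exponent. Let $H_{2n}\le B_{2n}$ be the Hilden subgroup, that is, the subgroup of those braids whose action on the plane with $2n$ marked points (regarded as part of the boundary sphere of the ball $B^3$) extends to a homeomorphism of the pair $(B^3,\tau_n)$, where $\tau_n$ is the standard trivial $n$-string tangle joining the marked points in adjacent pairs. Let $\mathcal P_{2n}=H_{2n}\backslash B_{2n}/H_{2n}$ be the set of Hilden double cosets. Let $c_n\colon B_{2n}\to\mathbb N$ be a proper complexity function, i.e. $\{\beta\in B_{2n} : c_n(\beta)\le N\}$ is finite for every $N\in\mathbb N$. For $C\in\mathcal P_{2n}$ let $M_n(C)$ be the (finite, nonempty) set of the elements of $C$ at which $c_n|_C$ takes its minimal value, and let $r_{D,n}(C)$ be the $<_D$-least element of $M_n(C)$. Let $\mathcal L$ be a link type in $S^3$, i.e. the ambient isotopy class of a tame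 (unoriented) link, and let $$\mathcal P^{(n)}(\mathcal L)=\{C\in\mathcal P_{2n} : \text{the plat closure of some } \beta\in C \text{ belongs to } \mathcal L\},$$ where the plat closure of a braid is obtained by joining its top endpoints, and its bottom endpoints, in adjacent pairs. Then the following are equivalent: 1. $\mathcal P^{(n)}(\mathcal L)$ is finite. 2. There is a constant $N=N(n,\mathcal L)\in\mathbb N$ (which may also depend on the fixed function $c_n$) such that $c_n(r_{D,n}(C))\le N$ for every $C\in\mathcal P^{(n)}(\mathcal L)$. -/

import Mathlib

noncomputable section

namespace Plat

/-! ### The braid group and the Dehornoy order -/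

/-- The Artin relations between the generators `σ 0, …, σ (m - 2)` on `m` strands. -/
inductive BraidRel (m : ℕ) : FreeGroup (Fin (m - 1)) → Prop
  | comm (i j : Fin (m - 1)) (h : i.val + 2 ≤ j.val) :
      BraidRel m (FreeGroup.of i * FreeGroup.of j *
        (FreeGroup.of j * FreeGroup.of i)⁻¹)
  | braid (i j : Fin (m - 1)) (h : i.val + 1 = j.val) :
      BraidRel m (FreeGroup.of i * FreeGroup.of j * FreeGroup.of i *
        (FreeGroup.of j * FreeGroup.of i * FreeGroup.of j)⁻¹)

/-- The braid group on `m` strands, in Artin's presentation. -/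
abbrev BraidGroup (m : ℕ) : Type :=
  PresentedGroup {r | BraidRel m r}

/-- Braid words: the letter `(i, true)` is `σ i` and `(i, false)` is its inverse. -/
abbrev BraidWord (m : ℕ) : Type := List (Fin (m - 1) × Bool)

/-- The braid represented by a braid word. -/
def BraidWord.toBraid {m : ℕ} (w : BraidWord m) : BraidGroup m :=
  PresentedGroup.mk {r | BraidRel m r} (FreeGroup.mk w)

/-- A braid is `σ`-positive if it is represented by some nonempty word in which the generator of
smallest index among those that occur only occurs with positive exponent. -/
def IsSigmaPositive {m : ℕ} (β : BraidGroup m) : Prop :=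
  ∃ (w : BraidWord m) (i : Fin (m - 1)), w.toBraid = β ∧
    (i, true) ∈ w ∧ (i, false) ∉ w ∧ ∀ x ∈ w, i ≤ x.1

/-- The (strict) Dehornoy order on the braid group. -/
def DehornoyLT {m : ℕ} (β γ : BraidGroup m) : Prop := IsSigmaPositive (β⁻¹ * γ)

/-- `β` is the least element of `S` for the Dehornoy order. -/
def IsDehornoyLeast {m : ℕ} (S : Set (BraidGroup m)) (β : BraidGroup m) : Prop :=
  β ∈ S ∧ ∀ γ ∈ S, γ ≠ β → DehornoyLT β γ

/-! ### Braids as homeomorphisms of the plane with marked points `0, 1, …, m - 1` -/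

/-- The angle function of a half twist: `1` for `r ≤ 1/2`, and `0` for `r ≥ 1`. -/
def twistProfile (r : ℝ) : ℝ := max 0 (min 1 (2 - 2 * r))

/-- Rotate the circle of radius `r` about `c` by the angle `s * π * twistProfile r`. -/
def twistMap (c : ℂ) (s : ℝ) (z : ℂ) : ℂ :=
  c + Complex.exp ((s * (Real.pi * twistProfile ‖z - c‖) : ℝ) * Complex.I) * (z - c)

theorem continuous_twistMap (c : ℂ) (s : ℝ) : Continuous (twistMap c s) := by
  unfold twistMap twistProfile
  fun_prop

theorem twistMap_twistMap (c : ℂ) (s : ℝ) (z : ℂ) :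
    twistMap c (-s) (twistMap c s z) = z := by
  have h : ‖twistMap c s z - c‖ = ‖z - c‖ := by
    simp only [twistMap, add_sub_cancel_left, norm_mul, Complex.norm_exp_ofReal_mul_I, one_mul]
  have h' : twistMap c (-s) (twistMap c s z) = c + Complex.exp
      ((-s * (Real.pi * twistProfile ‖twistMap c s z - c‖) : ℝ) * Complex.I) *
        (twistMap c s z - c) := rfl
  rw [h', h]
  simp only [twistMap, add_sub_cancel_left]
  rw [← mul_assoc, ← Complex.exp_add]
  simp

/-- The point half way between the marked points `i` and `i + 1`. -/
def midpt (i : ℕ) : ℂ := (i : ℂ) + 1 / 2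

/-- The half twist exchanging the marked points `i` and `i + 1`; it is supported in the disc of
radius `1` about their midpoint, hence fixes all other marked points. -/
def halfTwist (i : ℕ) : ℂ ≃ₜ ℂ where
  toFun := twistMap (midpt i) 1
  invFun := twistMap (midpt i) (-1)
  left_inv := twistMap_twistMap (midpt i) 1
  right_inv z := by simpa using twistMap_twistMap (midpt i) (-1) z
  continuous_toFun := continuous_twistMap _ _
  continuous_invFun := continuous_twistMap _ _

/-- The homeomorphism of the plane by which a braid word acts. -/
def planeAction (m : ℕ) : FreeGroup (Fin (m - 1)) →* (ℂ ≃ₜ ℂ) :=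
  FreeGroup.lift fun i => halfTwist i.val

/-! ### The standard trivial tangle and the Hilden subgroup -/

/-- The closed upper half space. -/
abbrev HalfSpace : Type := {p : ℂ × ℝ // 0 ≤ p.2}

/-- The closed 3-ball, as the one-point compactification of the closed upper half space. -/
abbrev Ball3 : Type := OnePoint HalfSpace

/-- The inclusion of the plane in the boundary sphere of the ball. -/
def bdry (z : ℂ) : Ball3 := ((⟨(z, 0), le_refl 0⟩ : HalfSpace) : OnePoint HalfSpace)

/-- The `n` semicircles in the upper half space over the adjacent pairs of marked points
`0, 1`, then `2, 3`, up to `2n - 2, 2n - 1`. -/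
def caps (n : ℕ) : Set (ℂ × ℝ) :=
  {p | 0 ≤ p.2 ∧ p.1.im = 0 ∧
    ∃ k < n, (p.1.re - (2 * (k : ℝ) + 1 / 2)) ^ 2 + p.2 ^ 2 = (1 / 2) ^ 2}

/-- The standard trivial `n`-string tangle in the ball. -/
def trivialTangle (n : ℕ) : Set Ball3 :=
  (fun p : HalfSpace => (p : OnePoint HalfSpace)) '' {p | p.val ∈ caps n}

/-- The homeomorphisms of the plane that extend to a homeomorphism of the pair formed by the
ball and the standard trivial tangle. -/
def extendable (n : ℕ) : Subgroup (ℂ ≃ₜ ℂ) where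
  carrier := {f | ∃ F : Ball3 ≃ₜ Ball3,
    (∀ z, F (bdry z) = bdry (f z)) ∧ F '' trivialTangle n = trivialTangle n}
  one_mem' := ⟨Homeomorph.refl _, fun _ => rfl, by simp⟩
  mul_mem' := by
    rintro f g ⟨F, hF, hF'⟩ ⟨G, hG, hG'⟩
    refine ⟨G.trans F, fun z => ?_, ?_⟩
    · simp only [Homeomorph.trans_apply, hG, hF]
      rfl
    · change (F ∘ G) '' trivialTangle n = trivialTangle n
      rw [Set.image_comp, hG', hF']
  inv_mem' := by
    rintro f ⟨F, hF, hF'⟩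
    refine ⟨F.symm, fun z => ?_, ?_⟩
    · rw [Homeomorph.symm_apply_eq, hF]
      exact congrArg bdry (f.apply_symm_apply z).symm
    · conv_lhs => rw [← hF']
      rw [← Set.image_comp]
      simp

/-- The Hilden subgroup of the braid group on `2n` strands. -/
def hilden (n : ℕ) : Subgroup (BraidGroup (2 * n)) :=
  ((extendable n).comap (planeAction (2 * n))).map
    (PresentedGroup.mk {r | BraidRel (2 * n) r})

/-- The set of `2n`-plat presentation classes: Hilden double cosets. -/
abbrev PlatClass (n : ℕ) : Type :=
  DoubleCoset.Quotient (hilden n : Set (BraidGroup (2 * n))) (hilden n : Set (BraidGroup (2 * n)))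

/-- A plat presentation class as a set of braids. -/
def PlatClass.braids {n : ℕ} (C : PlatClass n) : Set (BraidGroup (2 * n)) :=
  {β | DoubleCoset.mk (hilden n) (hilden n) β = C}

/-! ### Links in the 3-sphere, link types, plat closures -/

/-- The 3-sphere, as the one-point compactification of 3-space. -/
abbrev Sphere3 : Type := OnePoint (ℂ × ℝ)

/-- A (tame) link: a nonempty closed locally flat 1-dimensional submanifold of the 3-sphere. -/
def IsLink (K : Set Sphere3) : Prop :=
  K.Nonempty ∧ IsClosed K ∧ ∀ p ∈ K, ∃ e : OpenPartialHomeomorph Sphere3 (ℂ × ℝ),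
    p ∈ e.source ∧ e.target = Set.univ ∧ e '' (e.source ∩ K) = {q | q.1 = 0}

/-- Ambient isotopy of subsets of the 3-sphere. -/
def AmbientIsotopic (K K' : Set Sphere3) : Prop :=
  ∃ H : unitInterval → (Sphere3 ≃ₜ Sphere3),
    Continuous (fun p : unitInterval × Sphere3 => H p.1 p.2) ∧
    H 0 = Homeomorph.refl Sphere3 ∧ H 1 '' K = K'

/-- A link type: the ambient isotopy class of a link. -/
def IsLinkType (L : Set (Set Sphere3)) : Prop :=
  ∃ K, IsLink K ∧ L = {K' | AmbientIsotopic K K'}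

/-- The positions in the plane of the `m` strands at time `s ∈ [0, 1]` of a letter of a braid
word: the strands at `i` and `i + 1` make half a turn about each other. -/
def letterPoints (m : ℕ) (x : Fin (m - 1) × Bool) (s : ℝ) : Set ℂ :=
  {z | ∃ l < m, l ≠ x.1.val ∧ l ≠ x.1.val + 1 ∧ z = (l : ℂ)} ∪
  {z | ∃ d : ℂ, (d = 1 / 2 ∨ d = -(1 / 2)) ∧
    z = midpt x.1.val +
      Complex.exp (((if x.2 then 1 else -1) * (Real.pi * s) : ℝ) * Complex.I) * d}

/-- The geometric braid of a word, running from height `0` down to height `-w.length`. -/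
def strands {m : ℕ} (w : BraidWord m) : Set (ℂ × ℝ) :=
  {p | ∃ (j : Fin w.length) (s : ℝ), 0 ≤ s ∧ s ≤ 1 ∧
    p.2 = -((j.val : ℝ) + s) ∧ p.1 ∈ letterPoints m (w.get j) s}

/-- The plat closure of a braid word: the top endpoints, and the bottom endpoints, of the
geometric braid are joined in adjacent pairs by semicircles. -/
def platClosure {n : ℕ} (w : BraidWord (2 * n)) : Set Sphere3 :=
  (fun p : ℂ × ℝ => (p : OnePoint (ℂ × ℝ))) ''
    (caps n ∪ strands w ∪ {p | (p.1, -(w.length : ℝ) - p.2) ∈ caps n})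

/-- The plat closure of the braid `β` belongs to the link type `L`. -/
def PlatRepresents {n : ℕ} (β : BraidGroup (2 * n)) (L : Set (Set Sphere3)) : Prop :=
  ∃ w : BraidWord (2 * n), w.toBraid = β ∧ platClosure w ∈ L

/-- The plat presentation classes that represent the link type `L`. (If `n` is smaller than the
bridge number of `L`, this is empty, since a plat closure on `2n` strands has `n` bridges.) -/
def platClasses (n : ℕ) (L : Set (Set Sphere3)) : Set (PlatClass n) :=
  {C | ∃ β ∈ C.braids, PlatRepresents β L}

/-! ### Complexity and canonical representatives -/

/-- Proper complexity functions at level `n`. -/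
def IsProperComplexity {n : ℕ} (c : BraidGroup (2 * n) → ℕ) : Prop :=
  ∀ N : ℕ, {β | c β ≤ N}.Finite

/-- The minimal complexity of a braid in the class. -/
def classComplexity {n : ℕ} (c : BraidGroup (2 * n) → ℕ) (C : PlatClass n) : ℕ :=
  sInf (c '' C.braids)

/-- The braids of minimal complexity in the class. -/
def minimalBraids {n : ℕ} (c : BraidGroup (2 * n) → ℕ) (C : PlatClass n) :
    Set (BraidGroup (2 * n)) :=
  {β | β ∈ C.braids ∧ c β = classComplexity c C}

theorem minimalBraids_nonempty {n : ℕ} (c : BraidGroup (2 * n) → ℕ) (C : PlatClass n) :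
    (minimalBraids c C).Nonempty := by
  have h : (c '' C.braids).Nonempty := by
    obtain ⟨β, hβ⟩ := Quotient.exists_rep C
    exact ⟨c β, β, hβ, rfl⟩
  obtain ⟨β, hβ, hc⟩ := Nat.sInf_mem h
  exact ⟨β, hβ, hc⟩

open Classical in
/-- The Dehornoy canonical representative: the least braid, for the Dehornoy order, among those
of minimal complexity in the class. (For a proper `c` these are finitely many, and the Dehornoy
order is total, so the least one exists; the second branch only makes the function total.) -/
def canonicalRep {n : ℕ} (c : BraidGroup (2 * n) → ℕ) (C : PlatClass n) :
    BraidGroup (2 * n) :=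
  if h : ∃ β, IsDehornoyLeast (minimalBraids c C) β then h.choose
  else (minimalBraids_nonempty c C).choose

end Plat

end

namespace Plat

theorem finite_iff_bddAbove_image_of_northcott {α β : Type*}
    [Preorder β] [IsDirectedOrder β] [Nonempty β] (f : α → β) [Northcott f] (s : Set α) :
    s.Finite ↔ BddAbove (f '' s) := by
  constructor
  · intro hs
    exact (hs.image f).bddAbove
  · rintro ⟨b, hb⟩
    exact (Northcott.finite_le (h := f) b).subset fun a ha => hb (Set.mem_image_of_mem f ha)

section CanonicalRep

variable {n : ℕ} (c : BraidGroup (2 * n) → ℕ)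

theorem canonicalRep_mem_minimalBraids (C : PlatClass n) :
    canonicalRep c C ∈ minimalBraids c C := by
  -- The fallback branch is also a minimal braid, so totality of the Dehornoy order does not enter.
  unfold canonicalRep
  split_ifs with h
  · exact h.choose_spec.1
  · exact (minimalBraids_nonempty c C).choose_spec

theorem leftInverse_mk_canonicalRep :
    Function.LeftInverse (DoubleCoset.mk (hilden n) (hilden n)) (canonicalRep c) :=
  fun C => (canonicalRep_mem_minimalBraids c C).1

theorem canonicalRep_injective : Function.Injective (canonicalRep c) :=
  (leftInverse_mk_canonicalRep c).injective

variable {c}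

theorem IsProperComplexity.northcott_comp_canonicalRep (hc : IsProperComplexity c) :
    Northcott (c ∘ canonicalRep c) where
  finite_le N := (hc N).preimage (canonicalRep_injective c).injOn

end CanonicalRep

end Plat

theorem mainTheorem3_general {n : ℕ} {c : Plat.BraidGroup (2 * n) → ℕ}
    (hc : Plat.IsProperComplexity c) (S : Set (Plat.PlatClass n)) :
    S.Finite ↔ ∃ N : ℕ, ∀ C ∈ S, c (Plat.canonicalRep c C) ≤ N := by
  have : Northcott (c ∘ Plat.canonicalRep c) := hc.northcott_comp_canonicalRep
  rw [Plat.finite_iff_bddAbove_image_of_northcott (c ∘ Plat.canonicalRep c)]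
  simp only [bddAbove_def, Set.forall_mem_image, Function.comp_apply]

theorem mainTheorem3 (n : ℕ) (hn : 1 ≤ n)
    (c : Plat.BraidGroup (2 * n) → ℕ) (hc : Plat.IsProperComplexity c)
    (L : Set (Set Plat.Sphere3)) (hL : Plat.IsLinkType L) :
    (Plat.platClasses n L).Finite ↔
      ∃ N : ℕ, ∀ C ∈ Plat.platClasses n L, c (Plat.canonicalRep c C) ≤ N :=
  mainTheorem3_general hc (Plat.platClasses n L)
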